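/- Terminology. For an integral extension $A\subset B$ of integral domains and $b\in B$, the integral degree $\mathrm{id}_A(b)$ is the least $n\geq 1$ such that $b$ is a root of a monic polynomial of degree $n$ with coefficients in $A$, and $\mathrm{d}_A(B)=\sup\{\mathrm{id}_A(b)\mid b\in B\}\in\mathbb{N}\cup\{\infty\}$. For an $A$-module $N$, $\mu_A(N)\in\mathbb{N}\cup\{\infty\}$ denotes the minimum of the cardinalities of the generating sets of $N$. The integral closure of a domain $A$ in its field of fractions is denoted by $\overline{A}$. For $\mathfrak{p}\in\mathrm{Spec}(A)$ and an $A$-algebra $B$, $A_{\mathfrak p}$ and $B_{\mathfrak p}$ denote the localizations of $A$ and $B$ at the multiplicatively closed set $A\setminus\mathfrak{p}$. Statement. Let $k$ be any field, let $t_1,t_2,\ldots$ be countably infinitely many indeterminates over $k$, and let $$R=k[t_i^2,t_i^3 : i\geq 1]\subset k[t_1,t_2,\ldots],\qquad \mathfrak{q}_n=(t_n^2,t_n^3)R\quad (n\geq 1).$$ Then $S=R\setminus\bigcup_{n\geq 1}\mathfrak{q}_n$ is a multiplicatively closed subset of $R$, and the ring $A=S^{-1}R$ is a noetherian domain of Krull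 dimension $1$ with $\mathrm{d}_A(\overline{A})=2$ and $\mu_A(\overline{A})=\infty$. Moreover, for this $A$, the function $\mathrm{d}:\mathrm{Spec}(A)\to\mathbb{N}$, $\mathrm{d}(\mathfrak{p})=\mathrm{d}_{A_{\mathfrak{p}}}(\overline{A}_{\mathfrak{p}})$, takes finite values and is not upper-semicontinuous, that is, for some integer $n\geq 1$ the set $\{\mathfrak{p}\in\mathrm{Spec}(A)\mid \mathrm{d}(\mathfrak{p})\geq n\}$ is not closed. In particular, there exists a one-dimensional noetherian domain $A$ with these properties. -/

import Mathlib

noncomputable section IntegralDegree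

/-- The integral degree `id_A(b)` of an element `b` of an `A`-algebra `B`: the least `n ≥ 1` such
that `b` is a root of a monic polynomial of degree `n` with coefficients in `A`
(`⊤` if there is none, i.e. if `b` is not integral over `A`). -/
def elementIntegralDegree (A : Type*) {B : Type*} [CommRing A] [CommRing B] [Algebra A B]
    (b : B) : ℕ∞ :=
  ⨅ (f : Polynomial A) (_ : f.Monic ∧ 1 ≤ f.natDegree ∧ Polynomial.aeval b f = 0),
    (f.natDegree : ℕ∞)

/-- The integral degree `d_A(B)`: the supremum, possibly infinite, of the integral degrees over `A`
of the elements of `B`. -/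
def integralDegree (A B : Type*) [CommRing A] [CommRing B] [Algebra A B] : ℕ∞ :=
  ⨆ b : B, elementIntegralDegree A b

/-- The minimal number of generators `μ_A(N)` of an `A`-module `N`, as an element of
`{0, 1, 2, …, ∞}`: the minimum of the cardinalities of the generating sets of `N`. -/
def minimalNumberOfGenerators (A N : Type*) [CommRing A] [AddCommGroup N] [Module A N] : ℕ∞ :=
  Cardinal.toENat (⊤ : Submodule A N).spanRank

/-- The function `p ↦ d_{A_p}(B_p)` on `Spec A`, where `A_p = S⁻¹A` and `B_p = S⁻¹B` for
`S = A ∖ p`. -/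
def localIntegralDegree (A B : Type*) [CommRing A] [CommRing B] [Algebra A B]
    (p : PrimeSpectrum A) : ℕ∞ :=
  integralDegree (Localization p.asIdeal.primeCompl)
    (Localization (Algebra.algebraMapSubmonoid B p.asIdeal.primeCompl))

/-- The integral closure of `A` in its total ring of fractions (its field of fractions if `A` is a
domain). -/
abbrev integralClosureInFractions (A : Type*) [CommRing A] :
    Subalgebra A (FractionRing A) :=
  integralClosure A (FractionRing A)

end IntegralDegree

noncomputable section Cusps

/-- The subring `k[tᵢ², tᵢ³ : i]` of the polynomial ring `k[tᵢ : i]` in countably many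
indeterminates. -/
abbrev cuspRing (k : Type*) [Field k] : Subalgebra k (MvPolynomial ℕ k) :=
  Algebra.adjoin k
    (Set.range (fun i : ℕ => (MvPolynomial.X i : MvPolynomial ℕ k) ^ 2) ∪
      Set.range (fun i : ℕ => (MvPolynomial.X i : MvPolynomial ℕ k) ^ 3))

/-- The element `tᵢ²` of `k[tᵢ², tᵢ³ : i]`. -/
def cuspRing.sq (k : Type*) [Field k] (i : ℕ) : cuspRing k :=
  ⟨MvPolynomial.X i ^ 2, Algebra.subset_adjoin (Or.inl ⟨i, rfl⟩)⟩

/-- The element `tᵢ³` of `k[tᵢ², tᵢ³ : i]`. -/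
def cuspRing.cube (k : Type*) [Field k] (i : ℕ) : cuspRing k :=
  ⟨MvPolynomial.X i ^ 3, Algebra.subset_adjoin (Or.inr ⟨i, rfl⟩)⟩

/-- The ideal `qₙ = (tₙ², tₙ³)` of `k[tᵢ², tᵢ³ : i]`. -/
def cuspIdeal (k : Type*) [Field k] (n : ℕ) : Ideal (cuspRing k) :=
  Ideal.span {cuspRing.sq k n, cuspRing.cube k n}

end Cusps

/-!
Write `P = k[tᵢ : i]`. The ring `R` consists of the polynomials in which no variable occurs with
exponent exactly `1` (`mem_cuspRing_iff`), and `qₙ` is the contraction of the prime ideal `(tₙ)` of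
`P` (`mem_cuspIdeal_iff`). In particular the `qₙ` are prime and `S` is a submonoid.

*The ring `A = S⁻¹R`.* An ideal of `R` contained in the union of the `qₙ` is contained in one of
them (`exists_le_cuspIdeal`): otherwise finite prime avoidance gives nonzero elements `f`, `g` of the
ideal with no `qₙ` containing both, and then `f + t_N² g`, with `t_N` a variable not occurring in `f`
or `g`, lies in no `qₙ`. As `P` is integral over `R` and `(tₙ)` has height one, `qₙ` has height one
(`eq_cuspIdeal_of_le`). So the nonzero primes of `A` are the `qₙA`, and they are finitely generated.
Cohen's theorem shows that `A` is noetherian, of dimension one.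

*Its integral closure.* Since `P` is factorial and integral over `R`, the integral closure of `A` is
`S⁻¹P` (`isIntegral_iff_exists_mul_eq`). For `f ∈ P`, let `f₀` be `f` with `tₙ` set to zero. Locally
at `qₙ` both `f₀` and `(f - f₀)²` lie in `R`, so `f² ∈ R + R f` locally at `qₙ`. The multipliers
needed for this form an ideal contained in no `qₙ`, so that `f² ∈ A + A f`
(`exists_mem_cuspSubmonoid_mul_sq_eq`). Hence the integral degree is at most two, and so are
all the local ones.

*Lower bounds.* Multiplying by an element of `R ∖ qₙ` does not remove the linear term of `tₙ`
(`mul_X_notMem_noLinear`). Therefore `tₙ` does not lie in `A` locally at `qₙ`, and the local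
integral degree is two there. Moreover `tₙ` is not in the `A`-module generated by fractions whose
numerators do not involve `tₙ`, so `S⁻¹P` is not finitely generated. At the generic point the
local integral degree is one, whereas every nonempty open subset of `Spec A` contains some `qₙA`;
this contradicts upper semicontinuity.
-/

open MvPolynomial

/-! ### The monomial description of `R` and of the ideals `qₙ` -/

theorem monomial_mem_cuspRing (k : Type*) [Field k] {m : ℕ →₀ ℕ} (hm : ∀ i, m i ≠ 1) (c : k) :
    monomial m c ∈ cuspRing k := by
  rw [monomial_eq]
  refine mul_mem ((cuspRing k).algebraMap_mem c) (prod_mem fun i _ => ?_)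
  have h2 : (X i : MvPolynomial ℕ k) ^ 2 ∈ cuspRing k := (cuspRing.sq k i).2
  have h3 : (X i : MvPolynomial ℕ k) ^ 3 ∈ cuspRing k := (cuspRing.cube k i).2
  change (X i : MvPolynomial ℕ k) ^ m i ∈ cuspRing k
  rcases Nat.even_or_odd' (m i) with ⟨a, ha | ha⟩
  · rw [ha, pow_mul]
    exact pow_mem h2 a
  · obtain ⟨b, rfl⟩ : ∃ b, a = b + 1 := Nat.exists_eq_succ_of_ne_zero fun h => hm i (by omega)
    rw [ha, show 2 * (b + 1) + 1 = 3 + 2 * b by ring, pow_add, pow_mul]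
    exact mul_mem h3 (pow_mem h2 b)

/-- The polynomials none of whose monomials has degree exactly `1` in the variable `X n`. -/
noncomputable def noLinear (k : Type*) [Field k] (n : ℕ) : Subalgebra k (MvPolynomial ℕ k) where
  carrier := {f | ∀ m ∈ f.support, m n ≠ 1}
  mul_mem' := by
    intro f g hf hg m hm
    classical
    obtain ⟨a, ha, b, hb, rfl⟩ := Finset.mem_add.mp (support_mul f g hm)
    have h1 := hf a ha
    have h2 := hg b hb
    rw [Finsupp.add_apply]
    omega
  add_mem' := by
    intro f g hf hg m hm
    classical
    rcases Finset.mem_union.mp (support_add hm) with h | h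
    exacts [hf m h, hg m h]
  algebraMap_mem' := by
    intro c m hm
    classical
    rw [algebraMap_eq, mem_support_iff, coeff_C] at hm
    have : m = 0 := by
      by_contra h
      exact hm (if_neg (Ne.symm h))
    simp [this]

theorem cuspRing_le_noLinear (k : Type*) [Field k] (n : ℕ) : cuspRing k ≤ noLinear k n := by
  classical
  refine Algebra.adjoin_le ?_
  rintro _ (⟨i, rfl⟩ | ⟨i, rfl⟩) m hm
  all_goals
    beta_reduce at hm
    rw [X_pow_eq_monomial] at hm
    obtain rfl := Finset.mem_singleton.mp (support_monomial_subset hm)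
    rw [Finsupp.single_apply]
    split <;> omega

theorem mem_cuspRing_iff {k : Type*} [Field k] {f : MvPolynomial ℕ k} :
    f ∈ cuspRing k ↔ ∀ m ∈ f.support, ∀ i, m i ≠ 1 := by
  refine ⟨fun h m hm i => cuspRing_le_noLinear k i h m hm, fun h => ?_⟩
  rw [f.as_sum]
  exact sum_mem fun m hm => monomial_mem_cuspRing k (h m hm) _

theorem X_dvd_iff_forall_mem_support {k : Type*} [Field k] {n : ℕ} {f : MvPolynomial ℕ k} :
    X n ∣ f ↔ ∀ m ∈ f.support, m n ≠ 0 := by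
  have := mem_ideal_span_X_image (x := f) (s := {n})
  simpa [Ideal.mem_span_singleton] using this

/-- The ideal `qₙ` is the contraction of the prime ideal `(X n)` of the polynomial ring. -/
theorem mem_cuspIdeal_iff {k : Type*} [Field k] {n : ℕ} {f : cuspRing k} :
    f ∈ cuspIdeal k n ↔ X n ∣ (f : MvPolynomial ℕ k) := by
  constructor
  · intro h
    have hle : cuspIdeal k n ≤ (Ideal.span {X n}).comap (cuspRing k).val.toRingHom := by
      refine Ideal.span_le.mpr ?_
      rintro _ (rfl | rfl)
      · exact Ideal.mem_span_singleton.mpr (dvd_pow_self _ two_ne_zero)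
      · exact Ideal.mem_span_singleton.mpr (dvd_pow_self _ three_ne_zero)
    exact Ideal.mem_span_singleton.mp (hle h)
  · intro h
    rw [X_dvd_iff_forall_mem_support] at h
    have hf := mem_cuspRing_iff.mp f.2
    have key : ∀ m : (f : MvPolynomial ℕ k).support, ∃ g ∈ cuspIdeal k n,
        (g : MvPolynomial ℕ k) = monomial m.1 (coeff m.1 (f : MvPolynomial ℕ k)) := by
      rintro ⟨m, hm⟩
      have h0 := h m hm
      have h1 := hf m hm
      have h1n := h1 n
      -- Split off `X n ^ d`, with `d = 3` if the exponent is `3` and `d = 2` otherwise.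
      obtain ⟨d, hd, hdm, hne⟩ : ∃ d, (d = 2 ∨ d = 3) ∧ d ≤ m n ∧ m n - d ≠ 1 := by
        by_cases h3 : m n = 3
        · exact ⟨3, by omega, by omega, by omega⟩
        · exact ⟨2, by omega, by omega, by omega⟩
      have hr : ∀ i, (m - Finsupp.single n d) i ≠ 1 := by
        intro i
        by_cases hi : n = i
        · subst hi; simpa using hne
        · simpa [Finsupp.single_apply, hi] using h1 i
      have hmem : (⟨X n ^ d, by rcases hd with rfl | rfl; exacts
          [(cuspRing.sq k n).2, (cuspRing.cube k n).2]⟩ : cuspRing k) ∈ cuspIdeal k n := by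
        rcases hd with rfl | rfl
        · exact Ideal.subset_span (Or.inl rfl)
        · exact Ideal.subset_span (Or.inr rfl)
      refine ⟨_, Ideal.mul_mem_left _ ⟨_, monomial_mem_cuspRing k hr
        (coeff m (f : MvPolynomial ℕ k))⟩ hmem, ?_⟩
      simp only [MulMemClass.mk_mul_mk, X_pow_eq_monomial, monomial_mul, mul_one]
      rw [tsub_add_cancel_of_le (Finsupp.single_le_iff.mpr hdm)]
    choose g hg hgm using key
    have : f = ∑ m : (f : MvPolynomial ℕ k).support, g m := by
      apply Subtype.ext
      rw [AddSubmonoidClass.coe_finsetSum]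
      simp only [hgm]
      conv_lhs => rw [(f : MvPolynomial ℕ k).as_sum]
      exact (Finset.sum_coe_sort _ fun m => monomial m (coeff m (f : MvPolynomial ℕ k))).symm
    rw [this]
    exact sum_mem fun m _ => hg m

theorem cuspIdeal_eq_comap (k : Type*) [Field k] (n : ℕ) :
    cuspIdeal k n = (Ideal.span {X n}).comap (algebraMap (cuspRing k) (MvPolynomial ℕ k)) :=
  Ideal.ext fun _ => mem_cuspIdeal_iff.trans Ideal.mem_span_singleton.symm

instance isPrime_span_X (k : Type*) [Field k] (n : ℕ) :
    (Ideal.span {(X n : MvPolynomial ℕ k)}).IsPrime :=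
  (Ideal.span_singleton_prime (X_ne_zero n)).mpr X_prime

instance isPrime_cuspIdeal (k : Type*) [Field k] (n : ℕ) : (cuspIdeal k n).IsPrime := by
  rw [cuspIdeal_eq_comap]
  infer_instance

/-- Multiplication by an element of `R ∖ qₙ` does not bring `X n` into `R`, since it does not kill
the linear term in `X n`. -/
theorem mul_X_notMem_noLinear {k : Type*} [Field k] {n : ℕ} {s : cuspRing k}
    (hs : s ∉ cuspIdeal k n) : (s : MvPolynomial ℕ k) * X n ∉ noLinear k n := by
  rw [mem_cuspIdeal_iff, X_dvd_iff_forall_mem_support] at hs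
  push Not at hs
  obtain ⟨m, hm, hmn⟩ := hs
  intro h
  refine h (m + Finsupp.single n 1) ?_ (by simp [hmn])
  rw [mem_support_iff, coeff_mul_X]
  exact mem_support_iff.mp hm

theorem mem_noLinear_of_notMem_vars {k : Type*} [Field k] {n : ℕ} {f : MvPolynomial ℕ k}
    (h : n ∉ f.vars) : f ∈ noLinear k n := by
  intro m hm
  have : m n = 0 := by
    by_contra h0
    exact h ((mem_vars_iff_mem_support n).mpr ⟨m, hm, Finsupp.mem_support_iff.mpr h0⟩)
  omega

/-! ### The prime ideals of `R` contained in the union of the `qₙ` -/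

theorem mem_vars_of_mem_cuspIdeal {k : Type*} [Field k] {n : ℕ} {f : cuspRing k} (h0 : f ≠ 0)
    (h : f ∈ cuspIdeal k n) : n ∈ (f : MvPolynomial ℕ k).vars := by
  rw [mem_cuspIdeal_iff, X_dvd_iff_forall_mem_support] at h
  obtain ⟨m, hm⟩ := support_nonempty.mpr (fun h => h0 (Subtype.ext h) :
    (f : MvPolynomial ℕ k) ≠ 0)
  exact (mem_vars_iff_mem_support n).mpr ⟨m, hm, Finsupp.mem_support_iff.mpr (h m hm)⟩

/-- If `N` occurs neither in `f` nor in `g`, then `f` and `X N ^ 2 * g` have no monomial in common,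
so a variable dividing `f + X N ^ 2 * g` divides both. -/
theorem mem_of_add_sq_mul_mem {k : Type*} [Field k] {n N : ℕ} {f g : cuspRing k} (h0 : f ≠ 0)
    (hf : N ∉ (f : MvPolynomial ℕ k).vars) (hg : N ∉ (g : MvPolynomial ℕ k).vars)
    (h : f + cuspRing.sq k N * g ∈ cuspIdeal k n) : f ∈ cuspIdeal k n ∧ g ∈ cuspIdeal k n := by
  have hf' : f ∈ cuspIdeal k n := by
    rw [mem_cuspIdeal_iff, X_dvd_iff_forall_mem_support] at h ⊢
    intro m hm
    refine h m ?_
    have hmN : m N = 0 := by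
      by_contra h1
      exact hf ((mem_vars_iff_mem_support N).mpr ⟨m, hm, Finsupp.mem_support_iff.mpr h1⟩)
    have : coeff m ((X N : MvPolynomial ℕ k) ^ 2 * (g : MvPolynomial ℕ k)) = 0 := by
      rw [mul_comm, X_pow_eq_monomial, coeff_mul_monomial', if_neg]
      intro hle
      have := Finsupp.single_le_iff.mp hle
      omega
    rw [mem_support_iff]
    change coeff m ((f : MvPolynomial ℕ k) + X N ^ 2 * (g : MvPolynomial ℕ k)) ≠ 0
    rw [coeff_add, this, add_zero]
    exact mem_support_iff.mp hm
  refine ⟨hf', ?_⟩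
  have h2 := (Ideal.add_mem_iff_right _ hf').mp h
  refine ((isPrime_cuspIdeal k n).mem_or_mem h2).resolve_left fun h3 => ?_
  rw [mem_cuspIdeal_iff] at h3
  have h4 : (X n : MvPolynomial ℕ k) ∣ X N := X_prime.dvd_of_dvd_pow h3
  obtain rfl : n = N := by
    by_contra hne
    rw [X_dvd_iff_forall_mem_support] at h4
    exact h4 (Finsupp.single N 1) (by simp [X, mem_support_iff]) (by simp [hne])
  exact hf (mem_vars_of_mem_cuspIdeal h0 hf')

/-- Infinite prime avoidance for the family `(qₙ)`. -/
theorem exists_le_cuspIdeal {k : Type*} [Field k] {I : Ideal (cuspRing k)}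
    (hI : ∀ f ∈ I, ∃ n, f ∈ cuspIdeal k n) : ∃ n, I ≤ cuspIdeal k n := by
  by_cases hbot : I = ⊥
  · exact ⟨0, hbot ▸ bot_le⟩
  obtain ⟨f, hfI, hf0⟩ := Submodule.exists_mem_ne_zero_of_ne_bot hbot
  by_contra! hno
  -- Only the finitely many `qₙ` with `n` occurring in `f` contain `f`; choose `g ∈ I` outside them.
  obtain ⟨g, hgI, hg⟩ : ∃ g ∈ I, ∀ n ∈ (f : MvPolynomial ℕ k).vars, g ∉ cuspIdeal k n := by
    by_contra! h
    have hsub : (I : Set (cuspRing k)) ⊆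
        ⋃ n ∈ (↑(f : MvPolynomial ℕ k).vars : Set ℕ), (cuspIdeal k n : Set (cuspRing k)) := by
      intro g hg
      obtain ⟨n, hn, hgn⟩ := h g hg
      exact Set.mem_biUnion hn hgn
    obtain ⟨n, -, hn⟩ := (Ideal.subset_union_prime 0 0
      fun n _ _ _ => isPrime_cuspIdeal k n).mp hsub
    exact hno n hn
  obtain ⟨N, hN⟩ := Infinite.exists_notMem_finset
    ((f : MvPolynomial ℕ k).vars ∪ (g : MvPolynomial ℕ k).vars)
  rw [Finset.notMem_union] at hN
  obtain ⟨n, hn⟩ := hI _ (I.add_mem hfI (I.mul_mem_left (cuspRing.sq k N) hgI))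
  obtain ⟨h1, h2⟩ := mem_of_add_sq_mul_mem hf0 hN.1 hN.2 hn
  exact hg n (mem_vars_of_mem_cuspIdeal hf0 h1) h2

instance isIntegral_cuspRing (k : Type*) [Field k] :
    Algebra.IsIntegral (cuspRing k) (MvPolynomial ℕ k) := by
  have hX : ∀ i, IsIntegral (cuspRing k) (X i : MvPolynomial ℕ k) := fun i =>
    IsIntegral.of_pow two_pos (isIntegral_algebraMap (x := cuspRing.sq k i))
  refine ⟨fun f => ?_⟩
  induction f using MvPolynomial.induction_on with
  | C a => exact isIntegral_algebraMap (x := algebraMap k (cuspRing k) a)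
  | add p q hp hq => exact hp.add hq
  | mul_X p i hp => exact hp.mul (hX i)

/-- The ideal `qₙ` has height one: a smaller prime lifts to a prime of the polynomial ring
contained in the height one prime `(X n)`. -/
theorem eq_cuspIdeal_of_le {k : Type*} [Field k] {n : ℕ} {p : Ideal (cuspRing k)} [p.IsPrime]
    (h0 : p ≠ ⊥) (hp : p ≤ cuspIdeal k n) : p = cuspIdeal k n := by
  refine le_antisymm hp ?_
  obtain ⟨P, -, hP, hPp⟩ := Ideal.exists_ideal_over_prime_of_isIntegral p
    (⊥ : Ideal (MvPolynomial ℕ k)) (by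
      rw [Ideal.comap_bot_of_injective _ Subtype.val_injective]; exact bot_le)
  obtain ⟨Q, hPQ, hQ, hQq⟩ := Ideal.exists_ideal_over_prime_of_isIntegral_of_isPrime
    (cuspIdeal k n) P (hPp.trans_le hp)
  -- By incomparability `(X n)` is the only prime over `qₙ`.
  have hXQ : (X n : MvPolynomial ℕ k) ∈ Q := by
    refine hQ.mem_of_pow_mem 2 ?_
    have : cuspRing.sq k n ∈ Q.comap (algebraMap (cuspRing k) (MvPolynomial ℕ k)) :=
      hQq ▸ Ideal.subset_span (Or.inl rfl)
    exact this
  have hQX : Q ≤ Ideal.span {X n} := by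
    by_contra hlt
    have h1 : Ideal.span {X n} < Q :=
      lt_of_le_not_ge ((Ideal.span_singleton_le_iff_mem _).mpr hXQ) hlt
    have h2 := Ideal.IsIntegral.comap_lt_comap (R := cuspRing k) h1
    have h3 := cuspIdeal_eq_comap k n
    rw [← hQq] at h3
    exact h2.ne h3.symm
  have hXP : (X n : MvPolynomial ℕ k) ∈ P := by
    obtain ⟨f, hfp, hf0⟩ := Submodule.exists_mem_ne_zero_of_ne_bot h0
    have hfP : (f : MvPolynomial ℕ k) ∈ P := by
      rw [← hPp] at hfp
      exact hfp
    obtain ⟨u, hfu, hu⟩ := (FiniteMultiplicity.of_prime_left (X_prime (R := k) (i := n))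
      (fun h => hf0 (Subtype.ext h))).exists_eq_pow_mul_and_not_dvd
    rw [hfu] at hfP
    refine hP.mem_of_pow_mem _ ((hP.mem_or_mem hfP).resolve_right fun huP => hu ?_)
    exact Ideal.mem_span_singleton.mp (hQX (hPQ huP))
  rw [← hPp, cuspIdeal_eq_comap]
  exact Ideal.comap_mono ((Ideal.span_singleton_le_iff_mem _).mpr hXP)

/-! ### Quadratic equations over `R` up to multipliers in `S` -/

/-- A polynomial without linear term in `X n` is locally at `qₙ` in `R`: the squares of the other
variables are units there, and multiplication by them removes the other linear terms. -/
theorem exists_mul_mem_cuspRing {k : Type*} [Field k] {f : MvPolynomial ℕ k} {n : ℕ}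
    (hf : f ∈ noLinear k n) : ∃ s : cuspRing k, s ∉ cuspIdeal k n ∧
      (s : MvPolynomial ℕ k) * f ∈ cuspRing k := by
  classical
  let μ : ℕ →₀ ℕ := Finsupp.indicator (f.vars.erase n) fun _ _ => 2
  have hμn : μ n = 0 := Finsupp.indicator_of_notMem (Finset.notMem_erase n _) _
  have hμ : ∀ i, μ i ≠ 1 := by
    intro i
    by_cases hi : i ∈ f.vars.erase n
    · rw [Finsupp.indicator_of_mem hi]; norm_num
    · rw [Finsupp.indicator_of_notMem hi]; norm_num
  refine ⟨⟨monomial μ 1, monomial_mem_cuspRing k hμ 1⟩, ?_, ?_⟩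
  · rw [mem_cuspIdeal_iff, X_dvd_iff_forall_mem_support]
    intro h
    exact h μ (by simp [mem_support_iff]) hμn
  · rw [mem_cuspRing_iff]
    intro m hm i
    obtain ⟨a, ha, b, hb, rfl⟩ := Finset.mem_add.mp (support_mul _ _ hm)
    obtain rfl := Finset.mem_singleton.mp (support_monomial_subset ha)
    rw [Finsupp.add_apply]
    by_cases hin : i = n
    · subst hin
      rw [hμn, zero_add]
      exact hf b hb
    · by_cases hbi : b i = 0
      · rw [hbi, add_zero]
        exact hμ i
      · have hi : i ∈ f.vars.erase n := Finset.mem_erase.mpr ⟨hin,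
          (mem_vars_iff_mem_support i).mpr ⟨b, hb, Finsupp.mem_support_iff.mpr hbi⟩⟩
        have : μ i = 2 := Finsupp.indicator_of_mem hi _
        omega

theorem X_sq_mul_mem_noLinear {k : Type*} [Field k] (n : ℕ) (f : MvPolynomial ℕ k) :
    X n ^ 2 * f ∈ noLinear k n := by
  classical
  intro m hm
  rw [X_pow_eq_monomial] at hm
  obtain ⟨a, ha, b, -, rfl⟩ := Finset.mem_add.mp (support_mul _ _ hm)
  obtain rfl := Finset.mem_singleton.mp (support_monomial_subset ha)
  rw [Finsupp.add_apply, Finsupp.single_eq_same]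
  omega

/-- Locally at `qₙ` every polynomial `f` is quadratic over `R`: if `f₀` is `f` with `X n` set to
zero, then `(f - f₀) ^ 2` is divisible by `X n ^ 2` and hence locally in `R`, as is `f₀`. -/
theorem exists_notMem_cuspIdeal_mul_sq_eq {k : Type*} [Field k] (f : MvPolynomial ℕ k) (n : ℕ) :
    ∃ s : cuspRing k, s ∉ cuspIdeal k n ∧ ∃ a b : cuspRing k,
      (s : MvPolynomial ℕ k) * f ^ 2 = a * f + b := by
  obtain ⟨g, f₀, hf₀, hf⟩ : ∃ g, ∃ f₀ ∈ noLinear k n, f = X n * g + f₀ := by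
    refine ⟨f.divMonomial (Finsupp.single n 1), f.modMonomial (Finsupp.single n 1), ?_,
      (divMonomial_add_modMonomial_single f n).symm⟩
    intro m hm h1
    refine mem_support_iff.mp hm (coeff_modMonomial_of_le f ?_)
    exact Finsupp.single_le_iff.mpr h1.ge
  obtain ⟨s, hs, hsf⟩ := exists_mul_mem_cuspRing hf₀
  obtain ⟨t, ht, htf⟩ := exists_mul_mem_cuspRing (X_sq_mul_mem_noLinear n (g ^ 2))
  refine ⟨s ^ 2 * t, ?_, t * s * ⟨_, hsf⟩ + t * s * ⟨_, hsf⟩,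
    s ^ 2 * ⟨_, htf⟩ - t * ⟨_, hsf⟩ ^ 2, ?_⟩
  · have := isPrime_cuspIdeal k n
    exact fun h => (this.mem_or_mem h).elim (fun h => hs (this.mem_of_pow_mem 2 h)) ht
  · push_cast
    rw [hf]
    ring

/-- The multiplicative set `S`, the complement of the union of the primes `qₙ`. -/
noncomputable def cuspSubmonoid (k : Type*) [Field k] : Submonoid (cuspRing k) :=
  ⨅ n, (cuspIdeal k n).primeCompl

theorem mem_cuspSubmonoid {k : Type*} [Field k] {s : cuspRing k} :
    s ∈ cuspSubmonoid k ↔ ∀ n, s ∉ cuspIdeal k n := by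
  simp [cuspSubmonoid, Submonoid.mem_iInf, Ideal.mem_primeCompl_iff]

theorem coe_cuspSubmonoid (k : Type*) [Field k] :
    (cuspSubmonoid k : Set (cuspRing k)) = (⋃ n : ℕ, (cuspIdeal k n : Set (cuspRing k)))ᶜ := by
  ext s
  simp [mem_cuspSubmonoid]

theorem cuspSubmonoid_le_nonZeroDivisors (k : Type*) [Field k] :
    cuspSubmonoid k ≤ nonZeroDivisors (cuspRing k) :=
  le_nonZeroDivisors_of_noZeroDivisors fun h => mem_cuspSubmonoid.mp h 0 (zero_mem _)

/-- The local quadratic equations glue: the multipliers `s` for which `s * f ^ 2` lies in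
`R + R f` form an ideal, which is contained in no `qₙ` and hence meets `S`. -/
theorem exists_mem_cuspSubmonoid_mul_sq_eq {k : Type*} [Field k] (f : MvPolynomial ℕ k) :
    ∃ s ∈ cuspSubmonoid k, ∃ a b : cuspRing k, (s : MvPolynomial ℕ k) * f ^ 2 = a * f + b := by
  let I : Ideal (cuspRing k) :=
    { carrier := {s | ∃ a b : cuspRing k, (s : MvPolynomial ℕ k) * f ^ 2 = a * f + b}
      zero_mem' := ⟨0, 0, by simp⟩
      add_mem' := by
        rintro s t ⟨a, b, h⟩ ⟨c, d, h'⟩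
        refine ⟨a + c, b + d, ?_⟩
        push_cast
        linear_combination h + h'
      smul_mem' := by
        rintro c s ⟨a, b, h⟩
        refine ⟨c * a, c * b, ?_⟩
        rw [smul_eq_mul]
        push_cast
        linear_combination (c : MvPolynomial ℕ k) * h }
  by_contra! hno
  obtain ⟨n, hn⟩ := exists_le_cuspIdeal (I := I) fun s ⟨a, b, h⟩ => by
    by_contra! hs
    exact hno s (mem_cuspSubmonoid.mpr hs) a b h
  obtain ⟨s, hs, hab⟩ := exists_notMem_cuspIdeal_mul_sq_eq f n
  exact hs (hn hab)

/-! ### The localization `A = S⁻¹R` -/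

theorem disjoint_cuspSubmonoid_cuspIdeal (k : Type*) [Field k] (n : ℕ) :
    Disjoint (cuspSubmonoid k : Set (cuspRing k)) (cuspIdeal k n) :=
  Set.disjoint_left.mpr fun _ hs => mem_cuspSubmonoid.mp hs n

/-- The prime ideal `qₙA` of the localization `A = S⁻¹R`. -/
noncomputable def cuspPrime (k A : Type*) [Field k] [CommRing A] [Algebra (cuspRing k) A]
    [IsLocalization (cuspSubmonoid k) A] (n : ℕ) : PrimeSpectrum A :=
  ⟨(cuspIdeal k n).map (algebraMap _ _),
    IsLocalization.isPrime_of_isPrime_disjoint (cuspSubmonoid k) _ _ (isPrime_cuspIdeal k n)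
      (disjoint_cuspSubmonoid_cuspIdeal k n)⟩

section Localization

variable {k : Type*} [Field k] {A : Type*} [CommRing A] [Algebra (cuspRing k) A]
  [IsLocalization (cuspSubmonoid k) A]

theorem algebraMap_mem_cuspPrime {n : ℕ} {f : cuspRing k} :
    algebraMap (cuspRing k) A f ∈ (cuspPrime k A n).asIdeal ↔
      f ∈ cuspIdeal k n := by
  have := IsLocalization.under_map_of_isPrime_disjoint (cuspSubmonoid k) A
    (isPrime_cuspIdeal k n) (disjoint_cuspSubmonoid_cuspIdeal k n)
  exact SetLike.ext_iff.mp this f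

theorem exists_eq_cuspPrime {p : PrimeSpectrum A}
    (hp : p.asIdeal ≠ ⊥) :
    ∃ n, p = cuspPrime k A n := by
  have hmap := IsLocalization.map_under (cuspSubmonoid k) A p.asIdeal
  have hdisj := ((IsLocalization.isPrime_iff_isPrime_disjoint (cuspSubmonoid k)
    A p.asIdeal).mp p.isPrime).2
  obtain ⟨n, hn⟩ := exists_le_cuspIdeal (I := p.asIdeal.under (cuspRing k)) fun f hf => by
    by_contra! h
    exact Set.disjoint_left.mp hdisj (mem_cuspSubmonoid.mpr h) hf
  refine ⟨n, PrimeSpectrum.ext ?_⟩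
  have := eq_cuspIdeal_of_le (fun h => hp (by rw [← hmap, h, Ideal.map_bot])) hn
  rw [← hmap, this]
  rfl

end Localization

theorem cuspPrime_ne_bot (k A : Type*) [Field k] [CommRing A]
    [Algebra (cuspRing k) A] [IsLocalization (cuspSubmonoid k) A] (n : ℕ) :
    (cuspPrime k A n).asIdeal ≠ ⊥ := by
  intro h
  have h1 : algebraMap (cuspRing k) A (cuspRing.sq k n) ∈
      (cuspPrime k A n).asIdeal :=
    algebraMap_mem_cuspPrime.mpr (Ideal.subset_span (Or.inl rfl))
  rw [h, Ideal.mem_bot, IsLocalization.to_map_eq_zero_iff _ (cuspSubmonoid_le_nonZeroDivisors k)]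
    at h1
  exact pow_ne_zero 2 (X_ne_zero n) (congrArg Subtype.val h1)

/-- By Cohen's theorem, since the nonzero primes are generated by two elements. -/
theorem isNoetherianRing_of_isLocalization_cuspSubmonoid (k A : Type*) [Field k] [CommRing A]
    [Algebra (cuspRing k) A] [IsLocalization (cuspSubmonoid k) A] : IsNoetherianRing A := by
  refine IsNoetherianRing.of_prime_ne_bot (R := A) fun p hp h0 => ?_
  obtain ⟨n, hn⟩ := exists_eq_cuspPrime (k := k) (p := ⟨p, hp⟩) h0
  have hpn : p = (cuspIdeal k n).map (algebraMap _ _) := congrArg PrimeSpectrum.asIdeal hn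
  rw [hpn]
  have hfg : (cuspIdeal k n).FG := Submodule.fg_span (Set.toFinite _)
  exact hfg.map _

theorem ringKrullDim_of_isLocalization_cuspSubmonoid (k A : Type*) [Field k] [CommRing A]
    [Algebra (cuspRing k) A] [IsLocalization (cuspSubmonoid k) A] [IsDomain A] :
    ringKrullDim A = 1 := by
  have hle : Ring.KrullDimLE 1 A := by
    refine Ring.KrullDimLE.mk₁' fun p h0 hp => ?_
    obtain ⟨M, hM, hpM⟩ := Ideal.exists_le_maximal p hp.ne_top
    obtain ⟨n, hn⟩ := exists_eq_cuspPrime (k := k) (p := ⟨M, hM.isPrime⟩)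
      (ne_bot_of_le_ne_bot h0 hpM)
    obtain ⟨m, hm⟩ := exists_eq_cuspPrime (k := k) (p := ⟨p, hp⟩) h0
    have hmn : cuspIdeal k m ≤ cuspIdeal k n := fun f hf => by
      rw [← algebraMap_mem_cuspPrime (A := A)] at hf ⊢
      rw [← hm] at hf
      rw [← hn]
      exact hpM hf
    have hm0 : cuspIdeal k m ≠ ⊥ := fun h => cuspPrime_ne_bot k A m
      ((congrArg _ h).trans Ideal.map_bot)
    have : p = M := by
      calc p = (cuspPrime k A m).asIdeal := congrArg PrimeSpectrum.asIdeal hm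
        _ = (cuspPrime k A n).asIdeal := congrArg (Ideal.map _) (eq_cuspIdeal_of_le hm0 hmn)
        _ = M := (congrArg PrimeSpectrum.asIdeal hn).symm
    rwa [this]
  refine eq_of_le_of_not_lt ?_ fun hlt => ?_
  · rw [← Nat.cast_one, ← Ring.krullDimLE_iff]
    exact hle
  · have h0 : ringKrullDim A ≤ 0 := Order.le_of_lt_succ hlt
    rw [← Nat.cast_zero, ← Ring.krullDimLE_iff] at h0
    have hmax : (⊥ : Ideal A).IsMaximal := Ideal.isPrime_bot.isMaximal'
    exact cuspPrime_ne_bot k A 0 (hmax.eq_of_le (cuspPrime k A 0).isPrime.ne_top bot_le).symm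

/-! ### Integral degrees one and two -/

theorem elementIntegralDegree_le_two {A B : Type*} [CommRing A] [Nontrivial A] [CommRing B]
    [Algebra A B] {b : B} {a c : A} (h : b ^ 2 = algebraMap A B a * b + algebraMap A B c) :
    elementIntegralDegree A b ≤ 2 := by
  have hdeg : (Polynomial.C a * Polynomial.X + Polynomial.C c).degree < ((2 : ℕ) : WithBot ℕ) :=
    Polynomial.degree_linear_le.trans_lt (by norm_num)
  have hmonic := Polynomial.monic_X_pow_sub (n := 2) hdeg
  have hnat : (Polynomial.X ^ 2 - (Polynomial.C a * Polynomial.X + Polynomial.C c)).natDegree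
      = 2 := by
    compute_degree!
  refine (iInf₂_le _ ⟨hmonic, hnat.ge.trans' one_le_two, ?_⟩).trans_eq (by rw [hnat]; rfl)
  simp [h]

theorem elementIntegralDegree_algebraMap_le_one {A B : Type*} [CommRing A] [Nontrivial A]
    [CommRing B] [Algebra A B] (a : A) : elementIntegralDegree A (algebraMap A B a) ≤ 1 := by
  have hnat := Polynomial.natDegree_X_sub_C a
  refine (iInf₂_le _ ⟨Polynomial.monic_X_sub_C a, hnat.ge, ?_⟩).trans_eq (by rw [hnat]; rfl)
  simp

theorem exists_algebraMap_eq_of_elementIntegralDegree_lt_two {A B : Type*} [CommRing A]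
    [CommRing B] [Algebra A B] {b : B} (h : elementIntegralDegree A b < 2) :
    ∃ a : A, algebraMap A B a = b := by
  simp only [elementIntegralDegree, iInf_lt_iff] at h
  obtain ⟨f, ⟨hf, h1, hb⟩, h2⟩ := h
  have hdeg : f.natDegree = 1 := by
    have : f.natDegree < 2 := by exact_mod_cast h2
    omega
  have hc : f.coeff 1 = 1 := by rw [← hdeg]; exact hf
  rw [Polynomial.eq_X_add_C_of_natDegree_le_one hdeg.le, hc] at hb
  refine ⟨-f.coeff 0, ?_⟩
  rw [map_neg, neg_eq_iff_add_eq_zero, add_comm]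
  simpa using hb

/-- If every element of `B` is quadratic over `A`, the same holds for the localizations. -/
theorem exists_sq_eq_of_isLocalization {A B : Type*} [CommRing A] [CommRing B] [Algebra A B]
    (M : Submonoid A) (A' B' : Type*) [CommRing A'] [CommRing B'] [Algebra A A'] [Algebra B B']
    [Algebra A' B'] [Algebra A B'] [IsScalarTower A A' B'] [IsScalarTower A B B']
    [IsLocalization M A'] [IsLocalization (Algebra.algebraMapSubmonoid B M) B']
    (h : ∀ b : B, ∃ a c : A, b ^ 2 = algebraMap A B a * b + algebraMap A B c) (x : B') :
    ∃ a c : A', x ^ 2 = algebraMap A' B' a * x + algebraMap A' B' c := by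
  obtain ⟨⟨b, ⟨_, t, ht, rfl⟩⟩, hx⟩ := IsLocalization.surj (Algebra.algebraMapSubmonoid B M) x
  obtain ⟨a, c, hac⟩ := h b
  let u : M := ⟨t, ht⟩
  refine ⟨IsLocalization.mk' A' a u, IsLocalization.mk' A' c (u * u), ?_⟩
  have ha := congrArg (algebraMap A' B') (IsLocalization.mk'_spec A' a u)
  have hc := congrArg (algebraMap A' B') (IsLocalization.mk'_spec A' c (u * u))
  have hb := congrArg (algebraMap B B') hac
  have hu : IsUnit (algebraMap A B' t) := by
    rw [IsScalarTower.algebraMap_apply A A' B']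
    exact (IsLocalization.map_units A' u).map _
  simp only [map_mul, map_add, map_pow, Submonoid.coe_mul, ← IsScalarTower.algebraMap_apply,
    show (u : A) = t from rfl] at ha hc hb hx
  refine (hu.pow 2).mul_left_cancel ?_
  linear_combination (x * algebraMap A B' t + algebraMap B B' b - algebraMap A B' a) * hx + hb
    - (x * algebraMap A B' t) * ha - hc

theorem localIntegralDegree_le_two {A B : Type*} [CommRing A] [CommRing B] [Algebra A B]
    (h : ∀ b : B, ∃ a c : A, b ^ 2 = algebraMap A B a * b + algebraMap A B c)
    (p : PrimeSpectrum A) : localIntegralDegree A B p ≤ 2 := by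
  refine iSup_le fun x => ?_
  have : Nontrivial (Localization p.asIdeal.primeCompl) :=
    inferInstanceAs (Nontrivial (Localization.AtPrime p.asIdeal))
  obtain ⟨a, c, hac⟩ := exists_sq_eq_of_isLocalization p.asIdeal.primeCompl
    (Localization p.asIdeal.primeCompl) _ h x
  exact elementIntegralDegree_le_two hac

/-- The local integral degree at `p` is one exactly if `A` and `B` agree locally at `p`. -/
theorem localIntegralDegree_lt_two_iff {A B : Type*} [CommRing A] [CommRing B] [Algebra A B]
    {p : PrimeSpectrum A} : localIntegralDegree A B p < 2 ↔
      ∀ b : B, ∃ u ∉ p.asIdeal, ∃ a : A, algebraMap A B u * b = algebraMap A B a := by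
  have : Nontrivial (Localization p.asIdeal.primeCompl) :=
    inferInstanceAs (Nontrivial (Localization.AtPrime p.asIdeal))
  constructor
  · intro h b
    obtain ⟨x, hx⟩ := exists_algebraMap_eq_of_elementIntegralDegree_lt_two
      ((le_iSup (elementIntegralDegree (Localization p.asIdeal.primeCompl)) (algebraMap B
        (Localization (Algebra.algebraMapSubmonoid B p.asIdeal.primeCompl)) b)).trans_lt h)
    obtain ⟨a, u, rfl⟩ := IsLocalization.exists_mk'_eq p.asIdeal.primeCompl x
    rw [IsLocalization.algebraMap_mk' B, IsLocalization.mk'_eq_iff_eq_mul, ← map_mul] at hx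
    obtain ⟨⟨_, v, hv, rfl⟩, h⟩ := IsLocalization.exists_of_eq
      (M := Algebra.algebraMapSubmonoid B p.asIdeal.primeCompl) hx
    refine ⟨v * u, p.asIdeal.primeCompl.mul_mem hv u.2, v * a, ?_⟩
    rw [map_mul, map_mul, h]
    ring
  · intro h
    refine lt_of_le_of_lt (iSup_le fun x => ?_) (b := 1) (by norm_num)
    obtain ⟨b, ⟨_, t, ht, rfl⟩, rfl⟩ := IsLocalization.exists_mk'_eq
      (Algebra.algebraMapSubmonoid B p.asIdeal.primeCompl) x
    obtain ⟨u, hu, a, hua⟩ := h b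
    have key := IsLocalization.algebraMap_mk' B (Localization p.asIdeal.primeCompl)
      (Localization (Algebra.algebraMapSubmonoid B p.asIdeal.primeCompl)) a
      (⟨u, hu⟩ * ⟨t, ht⟩ : p.asIdeal.primeCompl)
    refine le_of_eq_of_le ?_ (elementIntegralDegree_algebraMap_le_one
      (B := Localization (Algebra.algebraMapSubmonoid B p.asIdeal.primeCompl))
      (IsLocalization.mk' (Localization p.asIdeal.primeCompl) a
        (⟨u, hu⟩ * ⟨t, ht⟩ : p.asIdeal.primeCompl)))
    rw [key, ← hua]
    congr 1
    rw [IsLocalization.mk'_eq_iff_eq]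
    congr 1
    simp
    ring

/-! ### The integral closure of `A` -/

section IntegralClosure

variable (k A K : Type*) [Field k] [CommRing A] [Field K]
  [Algebra (cuspRing k) A] [IsLocalization (cuspSubmonoid k) A] [Algebra A K]

/-- The embedding of the polynomial ring into the field of fractions `K` of `A = S⁻¹R` that extends
the embedding of `R`: the variable `X i` is sent to `tᵢ³ / tᵢ²`. -/
noncomputable def cuspEmbedding : MvPolynomial ℕ k →+* K :=
  eval₂Hom ((algebraMap A K).comp ((algebraMap (cuspRing k) A).comp (algebraMap k (cuspRing k))))
    fun i => algebraMap A K (algebraMap (cuspRing k) A (cuspRing.cube k i)) /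
      algebraMap A K (algebraMap (cuspRing k) A (cuspRing.sq k i))

variable {A} in
theorem exists_mul_algebraMap_eq (a : A) :
    ∃ r, ∃ s ∈ cuspSubmonoid k, algebraMap A K a * algebraMap A K (algebraMap (cuspRing k) A s) =
      algebraMap A K (algebraMap (cuspRing k) A r) := by
  obtain ⟨⟨r, s⟩, h⟩ := IsLocalization.surj (cuspSubmonoid k) a
  exact ⟨r, s, s.2, by rw [← map_mul, h]⟩

variable [IsFractionRing A K]

theorem algebraMap_comp_algebraMap_injective :
    Function.Injective fun r : cuspRing k => algebraMap A K (algebraMap (cuspRing k) A r) :=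
  (IsFractionRing.injective A K).comp
    (IsLocalization.injective _ (cuspSubmonoid_le_nonZeroDivisors k))

variable {k}

theorem algebraMap_algebraMap_ne_zero {r : cuspRing k} (hr : r ≠ 0) :
    algebraMap A K (algebraMap (cuspRing k) A r) ≠ 0 := fun h =>
  hr (algebraMap_comp_algebraMap_injective k A K (by simpa using h))

theorem algebraMap_algebraMap_ne_zero_of_mem {s : cuspRing k} (hs : s ∈ cuspSubmonoid k) :
    algebraMap A K (algebraMap (cuspRing k) A s) ≠ 0 :=
  algebraMap_algebraMap_ne_zero A K
    (nonZeroDivisors.ne_zero (cuspSubmonoid_le_nonZeroDivisors k hs))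

theorem cuspEmbedding_coe (r : cuspRing k) :
    cuspEmbedding k A K r = algebraMap A K (algebraMap (cuspRing k) A r) := by
  have hrel : ∀ i, algebraMap A K (algebraMap (cuspRing k) A (cuspRing.cube k i)) ^ 2 =
      algebraMap A K (algebraMap (cuspRing k) A (cuspRing.sq k i)) ^ 3 := by
    intro i
    rw [← map_pow, ← map_pow, ← map_pow, ← map_pow]
    refine congrArg _ (congrArg _ (Subtype.ext ?_))
    change (X i ^ 3) ^ 2 = ((X i : MvPolynomial ℕ k) ^ 2) ^ 3
    ring
  have hne : ∀ i, algebraMap A K (algebraMap (cuspRing k) A (cuspRing.sq k i)) ≠ 0 := fun i =>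
    algebraMap_algebraMap_ne_zero A K fun h => pow_ne_zero 2 (X_ne_zero i) (congrArg Subtype.val h)
  have hX : ∀ i, cuspEmbedding k A K (X i) =
      algebraMap A K (algebraMap (cuspRing k) A (cuspRing.cube k i)) /
        algebraMap A K (algebraMap (cuspRing k) A (cuspRing.sq k i)) :=
    fun i => eval₂Hom_X' _ _ _
  suffices h : ∀ g (hg : g ∈ cuspRing k),
      cuspEmbedding k A K g = algebraMap A K (algebraMap (cuspRing k) A ⟨g, hg⟩) from h r r.2
  intro g hg
  induction hg using Algebra.adjoin_induction with
  | mem x hx =>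
    rcases hx with ⟨i, rfl⟩ | ⟨i, rfl⟩
    · change cuspEmbedding k A K (X i ^ 2) =
        algebraMap A K (algebraMap (cuspRing k) A (cuspRing.sq k i))
      rw [map_pow, hX, div_pow, hrel, div_eq_iff (pow_ne_zero 2 (hne i))]
      ring
    · change cuspEmbedding k A K (X i ^ 3) =
        algebraMap A K (algebraMap (cuspRing k) A (cuspRing.cube k i))
      rw [map_pow, hX, div_pow, div_eq_iff (pow_ne_zero 3 (hne i)), ← hrel]
      ring
  | algebraMap c => exact eval₂Hom_C _ _ _
  | add x y hx hy h1 h2 => rw [map_add, h1, h2, ← map_add, ← map_add]; rfl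
  | mul x y hx hy h1 h2 => rw [map_mul, h1, h2, ← map_mul, ← map_mul]; rfl

variable (k) in
theorem cuspEmbedding_injective : Function.Injective (cuspEmbedding k A K) := by
  rw [injective_iff_map_eq_zero]
  intro f hf
  by_contra h0
  -- Multiplied by the squares of its variables, `f` lies in `R`.
  obtain ⟨r, hr, hrf⟩ : ∃ r : cuspRing k, r ≠ 0 ∧ (r : MvPolynomial ℕ k) * f ∈ cuspRing k := by
    obtain ⟨n, hn⟩ := Infinite.exists_notMem_finset f.vars
    obtain ⟨s, hs, hsf⟩ := exists_mul_mem_cuspRing (mem_noLinear_of_notMem_vars hn)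
    exact ⟨s, fun h => hs (h ▸ zero_mem _), hsf⟩
  refine algebraMap_algebraMap_ne_zero A K (r := ⟨_, hrf⟩) ?_ ?_
  · exact fun h => mul_ne_zero (fun h => hr (Subtype.ext h)) h0 (congrArg Subtype.val h)
  · rw [← cuspEmbedding_coe, map_mul, hf, mul_zero]

variable {A}

variable (k A) in
theorem isFractionRing_cuspEmbedding :
    letI := (cuspEmbedding k A K).toAlgebra
    IsFractionRing (MvPolynomial ℕ k) K := by
  let := (cuspEmbedding k A K).toAlgebra
  have : FaithfulSMul (MvPolynomial ℕ k) K :=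
    (faithfulSMul_iff_algebraMap_injective _ _).mpr (cuspEmbedding_injective k A K)
  refine IsFractionRing.of_field _ _ fun z => ?_
  obtain ⟨a, b, -, rfl⟩ := IsFractionRing.div_surjective (A := A) z
  obtain ⟨r, s, hs, ha⟩ := exists_mul_algebraMap_eq k K a
  obtain ⟨r', s', hs', hb⟩ := exists_mul_algebraMap_eq k K b
  refine ⟨r * s', r' * s, ?_⟩
  have h1 := algebraMap_algebraMap_ne_zero_of_mem A K hs
  have h2 := algebraMap_algebraMap_ne_zero_of_mem A K hs'
  rw [RingHom.algebraMap_toAlgebra]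
  simp only [map_mul, cuspEmbedding_coe, ← ha, ← hb]
  rw [mul_right_comm, mul_assoc, mul_assoc, mul_div_mul_right _ _ (mul_ne_zero h2 h1)]

/-- The integral closure of `A` is `S⁻¹k[tᵢ : i]`: the polynomial ring is integral over `R` and,
being factorial, integrally closed. -/
theorem isIntegral_iff_exists_mul_eq {x : K} :
    IsIntegral A x ↔ ∃ f, ∃ s ∈ cuspSubmonoid k,
      x * algebraMap A K (algebraMap (cuspRing k) A s) = cuspEmbedding k A K f := by
  have hcomp : (algebraMap A K).comp (algebraMap (cuspRing k) A) =
      (cuspEmbedding k A K).comp (algebraMap (cuspRing k) (MvPolynomial ℕ k)) :=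
    RingHom.ext fun r => (cuspEmbedding_coe A K r).symm
  constructor
  · intro h
    let := ((algebraMap A K).comp (algebraMap (cuspRing k) A)).toAlgebra
    have : IsScalarTower (cuspRing k) A K := .of_algebraMap_eq fun _ => rfl
    obtain ⟨s, p, hp, hps⟩ := h.exists_multiple_integral_of_isLocalization (cuspSubmonoid k) x
    have hP : (cuspEmbedding k A K).IsIntegralElem
        (x * algebraMap A K (algebraMap (cuspRing k) A s)) := by
      refine ⟨p.map (algebraMap (cuspRing k) (MvPolynomial ℕ k)), hp.map _, ?_⟩
      rw [Polynomial.eval₂_map, ← hcomp, mul_comm, ← hps, Submonoid.smul_def, Algebra.smul_def]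
      rfl
    let := (cuspEmbedding k A K).toAlgebra
    have := isFractionRing_cuspEmbedding k A K
    obtain ⟨f, hf⟩ := (IsIntegrallyClosed.isIntegral_iff (R := MvPolynomial ℕ k)).mp hP
    exact ⟨f, s, s.2, hf.symm⟩
  · rintro ⟨f, s, hs, h⟩
    have hf : IsIntegral A (cuspEmbedding k A K f) :=
      (Algebra.IsIntegral.isIntegral (R := cuspRing k) f).map_of_comp_eq
        (algebraMap (cuspRing k) A) (cuspEmbedding k A K) hcomp
    have hu : algebraMap A K (algebraMap (cuspRing k) A s) *
        algebraMap A K (IsLocalization.mk' A 1 (⟨s, hs⟩ : cuspSubmonoid k)) = 1 := by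
      rw [← map_mul, IsLocalization.mul_mk'_eq_mk'_of_mul, mul_one, IsLocalization.mk'_self, map_one]
    rw [← mul_one x, ← hu, ← mul_assoc, h]
    exact hf.mul isIntegral_algebraMap

variable (k A)

/-- The variable `X n` as an element of the integral closure of `A`. -/
noncomputable def cuspVar (n : ℕ) : integralClosure A K :=
  ⟨cuspEmbedding k A K (X n), (isIntegral_iff_exists_mul_eq K).mpr
    ⟨X n, 1, one_mem _, by rw [map_one, map_one, mul_one]⟩⟩

variable {k A K}

/-- The variable `X n` does not lie in `A` locally at `qₙ`. -/
theorem mul_cuspVar_ne {n : ℕ} {u : A} (hu : u ∉ (cuspPrime k A n).asIdeal) (a : A) :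
    algebraMap A (integralClosure A K) u * cuspVar k A K n ≠
      algebraMap A (integralClosure A K) a := by
  intro h
  obtain ⟨r, s, rfl⟩ := IsLocalization.exists_mk'_eq (cuspSubmonoid k) u
  have hr : r ∉ cuspIdeal k n := fun h => hu
    (IsLocalization.mk'_mem_iff.mpr (algebraMap_mem_cuspPrime.mpr h))
  obtain ⟨r', s', hs', ha⟩ := exists_mul_algebraMap_eq k K a
  have h1 : algebraMap A K (IsLocalization.mk' A r s) * cuspEmbedding k A K (X n) =
      algebraMap A K a :=
    congrArg Subtype.val h
  have h2 := congrArg (algebraMap A K) (IsLocalization.mk'_spec A r s)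
  rw [map_mul] at h2
  have h3 : cuspEmbedding k A K (((r * s' : cuspRing k) : MvPolynomial ℕ k) * X n) =
      cuspEmbedding k A K (r' * s : cuspRing k) := by
    rw [map_mul, cuspEmbedding_coe, cuspEmbedding_coe, map_mul, map_mul, map_mul, map_mul, ← ha,
      ← h1, ← h2]
    ring
  refine mul_X_notMem_noLinear (s := r * s') (n := n) ?_ ?_
  · exact fun h => ((isPrime_cuspIdeal k n).mem_or_mem h).elim hr (mem_cuspSubmonoid.mp hs' n)
  · rw [cuspEmbedding_injective k A K h3]
    exact cuspRing_le_noLinear k n (r' * s).2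

variable (k A K)

/-- The elements `f / s` of the integral closure of `A` whose numerator `f` has no linear term in
`X n` form an `A`-submodule. -/
noncomputable def noLinearSubmodule (n : ℕ) : Submodule A (integralClosure A K) where
  carrier := {x | ∃ f ∈ noLinear k n, ∃ s ∈ cuspSubmonoid k,
    (x : K) * algebraMap A K (algebraMap (cuspRing k) A s) = cuspEmbedding k A K f}
  zero_mem' := ⟨0, zero_mem _, 1, one_mem _, by simp⟩
  add_mem' := by
    rintro x y ⟨f, hf, s, hs, hx⟩ ⟨g, hg, t, ht, hy⟩
    refine ⟨f * t + g * s, add_mem (mul_mem hf (cuspRing_le_noLinear k n t.2))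
      (mul_mem hg (cuspRing_le_noLinear k n s.2)), s * t, mul_mem hs ht, ?_⟩
    rw [map_add, map_mul (cuspEmbedding k A K), map_mul (cuspEmbedding k A K), cuspEmbedding_coe,
      cuspEmbedding_coe, ← hx, ← hy, map_mul, map_mul]
    change ((x : K) + y) * _ = _
    ring
  smul_mem' := by
    rintro a x ⟨f, hf, s, hs, hx⟩
    obtain ⟨r, t, ht, ha⟩ := exists_mul_algebraMap_eq k K a
    refine ⟨r * f, mul_mem (cuspRing_le_noLinear k n r.2) hf, t * s, mul_mem ht hs, ?_⟩
    rw [map_mul (cuspEmbedding k A K), cuspEmbedding_coe, ← hx, ← ha, map_mul, map_mul,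
      Algebra.smul_def]
    change (algebraMap A K a * (x : K)) * _ = _
    ring

theorem cuspVar_notMem_noLinearSubmodule (n : ℕ) :
    cuspVar k A K n ∉ noLinearSubmodule k A K n := by
  rintro ⟨f, hf, s, hs, h⟩
  have h1 : cuspEmbedding k A K ((s : MvPolynomial ℕ k) * X n) = cuspEmbedding k A K f := by
    rw [map_mul, cuspEmbedding_coe, mul_comm]
    exact h
  exact mul_X_notMem_noLinear (mem_cuspSubmonoid.mp hs n) (cuspEmbedding_injective k A K h1 ▸ hf)

theorem two_le_localIntegralDegree_cuspPrime (n : ℕ) :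
    2 ≤ localIntegralDegree A (integralClosure A K) (cuspPrime k A n) := by
  by_contra! h
  obtain ⟨u, hu, a, ha⟩ := localIntegralDegree_lt_two_iff.mp h (cuspVar k A K n)
  exact mul_cuspVar_ne hu a ha

variable {A} in
/-- Every nonempty open set of `Spec A` contains some `qₙA`, in fact all but finitely many. -/
theorem exists_cuspPrime_mem_of_isOpen {U : Set (PrimeSpectrum A)} (hU : IsOpen U)
    (h : U.Nonempty) : ∃ n, cuspPrime k A n ∈ U := by
  obtain ⟨p, hp⟩ := h
  obtain ⟨_, ⟨a, rfl⟩, hpa, haU⟩ :=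
    PrimeSpectrum.isTopologicalBasis_basic_opens.exists_subset_of_mem_open hp hU
  obtain ⟨r, s, rfl⟩ := IsLocalization.exists_mk'_eq (cuspSubmonoid k) a
  have hr : r ≠ 0 := by
    rintro rfl
    rw [IsLocalization.mk'_zero] at hpa
    exact hpa (zero_mem _)
  obtain ⟨n, hn⟩ := Infinite.exists_notMem_finset (r : MvPolynomial ℕ k).vars
  refine ⟨n, haU fun h => hn (mem_vars_of_mem_cuspIdeal hr ?_)⟩
  exact algebraMap_mem_cuspPrime.mp (IsLocalization.mk'_mem_iff.mp h)

end IntegralClosure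

/-! ### Degree, number of generators and semicontinuity -/

/-- The local quadratic equations over `R` become a global one over `A`, because the elements of
`S` are units there. -/
theorem exists_sq_eq_of_integralClosure (k A K : Type*) [Field k] [CommRing A] [Field K]
    [Algebra (cuspRing k) A] [IsLocalization (cuspSubmonoid k) A] [Algebra A K]
    [IsFractionRing A K] (b : integralClosure A K) :
    ∃ a c : A, b ^ 2 = algebraMap A (integralClosure A K) a * b +
      algebraMap A (integralClosure A K) c := by
  obtain ⟨f, s, hs, hf⟩ := (isIntegral_iff_exists_mul_eq (k := k) K).mp b.2
  obtain ⟨t, ht, a, c, h⟩ := exists_mem_cuspSubmonoid_mul_sq_eq f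
  let s' : cuspSubmonoid k := ⟨s, hs⟩
  let t' : cuspSubmonoid k := ⟨t, ht⟩
  refine ⟨IsLocalization.mk' A a (t' * s'), IsLocalization.mk' A c (t' * s' * s'),
    Subtype.ext ?_⟩
  change (b : K) ^ 2 = algebraMap A K _ * (b : K) + algebraMap A K _
  have ha := congrArg (algebraMap A K) (IsLocalization.mk'_spec A a (t' * s'))
  have hc := congrArg (algebraMap A K) (IsLocalization.mk'_spec A c (t' * s' * s'))
  have h' := congrArg (cuspEmbedding k A K) h
  have h1 := algebraMap_algebraMap_ne_zero_of_mem A K hs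
  have h2 := algebraMap_algebraMap_ne_zero_of_mem A K ht
  simp only [map_mul, map_add, map_pow, cuspEmbedding_coe, ← hf, Submonoid.coe_mul,
    show (s' : cuspRing k) = s from rfl, show (t' : cuspRing k) = t from rfl] at ha hc h'
  refine mul_left_cancel₀ (mul_ne_zero (mul_ne_zero h2 h1) h1) ?_
  linear_combination h' - (algebraMap A K (algebraMap (cuspRing k) A s) * b) * ha - hc

/-- Finitely many elements involve only finitely many variables; for another variable `X n` they
all lie in `noLinearSubmodule k A K n`, which does not contain `X n`. -/
theorem minimalNumberOfGenerators_integralClosure (k A K : Type*) [Field k] [CommRing A] [Field K]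
    [Algebra (cuspRing k) A] [IsLocalization (cuspSubmonoid k) A] [Algebra A K]
    [IsFractionRing A K] : minimalNumberOfGenerators A (integralClosure A K) = ⊤ := by
  rw [minimalNumberOfGenerators, Cardinal.toENat_eq_top, ← not_lt,
    Submodule.spanRank_finite_iff_fg]
  rintro ⟨G, hG⟩
  choose f s hs hf using fun x : integralClosure A K =>
    (isIntegral_iff_exists_mul_eq (k := k) K).mp x.2
  classical
  obtain ⟨n, hn⟩ := Infinite.exists_notMem_finset (G.biUnion fun x => (f x).vars)
  have hle : ⊤ ≤ noLinearSubmodule k A K n := by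
    rw [← hG, Submodule.span_le]
    exact fun x hx => ⟨f x, mem_noLinear_of_notMem_vars
      fun h => hn (Finset.mem_biUnion.mpr ⟨x, hx, h⟩), s x, hs x, hf x⟩
  exact cuspVar_notMem_noLinearSubmodule k A K n (hle trivial)

theorem integralDegree_integralClosure (k A K : Type*) [Field k] [CommRing A] [Nontrivial A]
    [Field K] [Algebra (cuspRing k) A] [IsLocalization (cuspSubmonoid k) A] [Algebra A K]
    [IsFractionRing A K] : integralDegree A (integralClosure A K) = 2 := by
  refine le_antisymm (iSup_le fun b => ?_) ?_
  · obtain ⟨a, c, h⟩ := exists_sq_eq_of_integralClosure k A K b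
    exact elementIntegralDegree_le_two h
  · by_contra! h
    obtain ⟨a, ha⟩ := exists_algebraMap_eq_of_elementIntegralDegree_lt_two
      ((le_iSup (elementIntegralDegree A) (cuspVar k A K 0)).trans_lt h)
    refine mul_cuspVar_ne (k := k) (K := K) (n := 0) (u := 1) ?_ a ?_
    · exact fun h => (cuspPrime k A 0).isPrime.ne_top ((Ideal.eq_top_iff_one _).mpr h)
    · rw [map_one, one_mul, ha]

theorem localIntegralDegree_integralClosure_ne_top (k A K : Type*) [Field k] [CommRing A] [Field K]
    [Algebra (cuspRing k) A] [IsLocalization (cuspSubmonoid k) A] [Algebra A K]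
    [IsFractionRing A K] (p : PrimeSpectrum A) :
    localIntegralDegree A (integralClosure A K) p ≠ ⊤ :=
  ne_top_of_le_ne_top (by decide)
    (localIntegralDegree_le_two (exists_sq_eq_of_integralClosure k A K) p)

/-- At the generic point both localizations are the field of fractions. -/
theorem localIntegralDegree_bot_lt_two (A K : Type*) [CommRing A] [IsDomain A] [Field K]
    [Algebra A K] [IsFractionRing A K] :
    localIntegralDegree A (integralClosure A K) ⟨⊥, Ideal.isPrime_bot⟩ < 2 := by
  rw [localIntegralDegree_lt_two_iff]
  intro b
  obtain ⟨a, u, hu, h⟩ := IsFractionRing.div_surjective (A := A) (b : K)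
  have hu0 := nonZeroDivisors.ne_zero hu
  refine ⟨u, hu0, a, Subtype.ext ?_⟩
  change algebraMap A K u * (b : K) = algebraMap A K a
  rw [← h, mul_div_cancel₀]
  exact (map_ne_zero_iff _ (IsFractionRing.injective A K)).mpr hu0

theorem not_upperSemicontinuous_localIntegralDegree (k A K : Type*) [Field k] [CommRing A]
    [IsDomain A] [Field K] [Algebra (cuspRing k) A] [IsLocalization (cuspSubmonoid k) A]
    [Algebra A K] [IsFractionRing A K] :
    ¬ UpperSemicontinuous (localIntegralDegree A (integralClosure A K)) := by
  intro h
  have h1 := h ⟨⊥, Ideal.isPrime_bot⟩ 2 (localIntegralDegree_bot_lt_two A K)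
  obtain ⟨U, hU, hUo, hbot⟩ := eventually_nhds_iff.mp h1
  obtain ⟨n, hn⟩ := exists_cuspPrime_mem_of_isOpen k hUo ⟨_, hbot⟩
  exact (two_le_localIntegralDegree_cuspPrime k A K n).not_gt (hU _ hn)

theorem mainTheorem12 (k : Type*) [Field k] :
    ∃ S : Submonoid (cuspRing k),
      (S : Set (cuspRing k)) = (⋃ n : ℕ, (cuspIdeal k n : Set (cuspRing k)))ᶜ ∧
      IsDomain (Localization S) ∧
      IsNoetherianRing (Localization S) ∧
      ringKrullDim (Localization S) = 1 ∧
      integralDegree (Localization S) (integralClosureInFractions (Localization S)) = 2 ∧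
      minimalNumberOfGenerators (Localization S)
        (integralClosureInFractions (Localization S)) = ⊤ ∧
      (∀ p : PrimeSpectrum (Localization S),
        localIntegralDegree (Localization S)
          (integralClosureInFractions (Localization S)) p ≠ ⊤) ∧
      ¬ UpperSemicontinuous
        (localIntegralDegree (Localization S)
          (integralClosureInFractions (Localization S))) := by
  let A := Localization (cuspSubmonoid k)
  have hA : IsDomain A :=
    IsLocalization.isDomain_localization (cuspSubmonoid_le_nonZeroDivisors k)
  have h1 := integralDegree_integralClosure k A (FractionRing A)
  have h2 := minimalNumberOfGenerators_integralClosure k A (FractionRing A)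
  have h3 := localIntegralDegree_integralClosure_ne_top k A (FractionRing A)
  have h4 := not_upperSemicontinuous_localIntegralDegree k A (FractionRing A)
  have h5 := isNoetherianRing_of_isLocalization_cuspSubmonoid k A
  have h6 := ringKrullDim_of_isLocalization_cuspSubmonoid k A
  exact ⟨cuspSubmonoid k, coe_cuspSubmonoid k, hA, h5, h6, h1, h2, h3, h4⟩
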